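/- For $n\in\mathbb N_0$ and functions on $\mathbb R^n$ with complex values, write $\widehat\phi(\xi)=(2\pi)^{-n}\int_{\mathbb R^n}e^{-ix\cdot\xi}\phi(x)\,dx$ for the Fourier transform, $\mathcal F^{-1}$ for its inverse, and $\widetilde m(\xi):=m(-\xi)$. Let $m:\mathbb R^n\to\mathbb C$ be continuous and such that the Fourier multiplier operator $$\phi\mapsto \widetilde m(D)\phi:=\mathcal F^{-1}(\widetilde m\,\widehat\phi)$$ maps $C_c^\infty(\mathbb R^n)$ into $L^1(\mathbb R^n)$; that is, for every $\phi\in C_c^\infty(\mathbb R^n)$ there is a (necessarily unique) $g=\widetilde m(D)\phi\in L^1(\mathbb R^n)$ with $\widehat g=\widetilde m\,\widehat\phi$. For $f\in L^\infty(\mathbb R^n)$ we say that $m(D)f=0$ as a distribution if $$\int_{\mathbb R^n} f(x)\,\bigl(\widetilde m(D)\phi\bigr)(x)\,dx=0\qquad\text{for all }\phi\in C_c^\infty(\mathbb R^n).\tag{$*$}$$ 1. If $\{\eta\in\mathbb R^n\mid m(\eta)=0\}\subseteq\{0\}$, then every $f\in L^\infty(\mathbb R^n)$ satisfying $(*)$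 is constant Lebesgue almost everywhere. 2. Conversely, if every $f\in L^\infty(\mathbb R^n)$ satisfying $(*)$ is constant Lebesgue almost everywhere, then $\{\eta\in\mathbb R^n\mid m(\eta)=0\}\subseteq\{0\}$. -/

import Mathlib

open MeasureTheory

/-- The Fourier transform `φ̂(ξ) = (2π)⁻ⁿ ∫ e^{-i x·ξ} φ(x) dx` on `ℝⁿ`. -/
noncomputable def fourierHat {n : ℕ} (φ : EuclideanSpace ℝ (Fin n) → ℂ)
    (ξ : EuclideanSpace ℝ (Fin n)) : ℂ :=
  ((2 * (Real.pi : ℂ)) ^ n)⁻¹ *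
    ∫ x, Complex.exp (-(Complex.I * ((inner ℝ x ξ : ℝ) : ℂ))) * φ x

/-- The (complex-valued) test functions `C_c^∞(ℝⁿ)`. -/
def IsTestFunction {n : ℕ} (φ : EuclideanSpace ℝ (Fin n) → ℂ) : Prop :=
  ContDiff ℝ (⊤ : ℕ∞) φ ∧ HasCompactSupport φ

/-- `g = 𝓕⁻¹ u` with `g ∈ L¹(ℝⁿ)`: the Fourier transform of `g` is `u`. As `ĝ` is a continuous
function, for a continuous `u` this is the equality of `𝓕 g` and `u` as tempered distributions, so
no integrability of `u` has to be assumed; `g` is determined by `u` up to a null set. -/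
def IsInverseFourierL1 {n : ℕ} (u g : EuclideanSpace ℝ (Fin n) → ℂ) : Prop :=
  Integrable g ∧ ∀ ξ, fourierHat g ξ = u ξ

/-- `g ∈ L¹(ℝⁿ)` is (a representative of) `κ(D)φ = 𝓕⁻¹(κ φ̂)`. -/
def IsMultiplierImage {n : ℕ} (κ φ g : EuclideanSpace ℝ (Fin n) → ℂ) : Prop :=
  IsInverseFourierL1 (fun ξ => κ ξ * fourierHat φ ξ) g

/-- The Fourier multiplier operator `κ(D)` maps `C_c^∞(ℝⁿ)` into `L¹(ℝⁿ)`. -/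
def MultiplierMapsIntoL1 {n : ℕ} (κ : EuclideanSpace ℝ (Fin n) → ℂ) : Prop :=
  ∀ φ, IsTestFunction φ → ∃ g, IsMultiplierImage κ φ g

/-- The reflection `m̃(ξ) = m(-ξ)`. -/
def reflectFun {n : ℕ} (m : EuclideanSpace ℝ (Fin n) → ℂ) : EuclideanSpace ℝ (Fin n) → ℂ :=
  fun ξ => m (-ξ)

/-- `m(D)f = 0` as a distribution: `⟨f, m̃(D)φ⟩ = 0` for all `φ ∈ C_c^∞(ℝⁿ)`, where
`⟨f, g⟩ = ∫ f g` is the bilinear dual pairing of `L^∞` and `L¹`. -/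
def IsDistribSolution {n : ℕ} (m f : EuclideanSpace ℝ (Fin n) → ℂ) : Prop :=
  ∀ φ, IsTestFunction φ → ∀ g, IsMultiplierImage (reflectFun m) φ g → ∫ x, f x * g x = 0

/-!
The second half is elementary: if `m η = 0`, the plane wave `x ↦ exp (i x·η)` is a bounded solution
(`isDistribSolution_planeWave`), and it is constant only for `η = 0`.

For the first half, fix a bounded `f` and write `correlation f g a = ∫ f(x) g(x - a) dx`. Since
test functions may be translated, `f` being a solution means that `correlation f k = 0` for every
`k = m̃(D)φ`; as `m` vanishes at most at `0`, for each `ξ ≠ 0` there is such a `k` with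
`𝓕 k ξ ≠ 0`. The theorem thus becomes a case of the Tauberian theorem of Wiener and Beurling,
`exists_ae_eq_const_of_correlation_eq_zero`, for which only convolutions with Schwartz functions are
needed.

* *Local step* (`exists_ball_correlation_eq_zero`). Let `u = correlation f ψ`, where `𝓕 ψ` is
  supported in a small ball around `ξ₀` and `𝓕 k ξ₀ ≠ 0`. Then `∫ k(z) u(a + z) dz = 0`, while
  `u(a) = ∫ h(y) u(a + y) dy` for a modulated dilation `h` of a fixed Schwartz function, with
  `𝓕 h = 1` on the ball. A translation of a very wide `h` is, up to a small `L¹` error, a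
  multiplication by a character. So `|𝓕 k ξ₀| · sup |u|` is at most a small multiple of `sup |u|`,
  and `u = 0` (`eq_zero_of_reproducing_of_annihilating`).
* *Gluing* (`correlation_eq_zero_of_hasCompactSupport_fourier`). Smooth cutoffs on the Fourier side
  give `correlation f ψ = 0` whenever `𝓕 ψ` has compact support away from `0`.
* *Conclusion.* Let `χ_ε` be the kernels at frequency `0`, for which `𝓕 χ_ε = 1` near `0`. By gluing
  `correlation f χ_ε` does not depend on `ε`. It is almost invariant under translations as `ε → 0`,
  hence a constant `c`; and `χ_ε` is an approximate identity as `ε → ∞`, hence `f = c` almost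
  everywhere.
-/

section LiouvilleTheorem

open Filter Topology Set FourierTransform Convolution SchwartzMap
open scoped ContDiff

/-! ### Correlation with a bounded function, and translation in `L¹` -/

section Correlation

variable {E : Type*} [NormedAddCommGroup E] [InnerProductSpace ℝ E] [FiniteDimensional ℝ E]
  [MeasurableSpace E] [BorelSpace E]

/-- The cross-correlation `a ↦ ∫ f(x) g(x - a) dx`: the bilinear pairing of `f` with the
translates of `g`. -/
noncomputable def correlation (f g : E → ℂ) (a : E) : ℂ := ∫ x, f x * g (x - a)

/-- The `L¹` modulus of continuity of `g`: the `L¹` distance of `g` to its translate by `w`. -/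
noncomputable def translationModulus (g : E → ℂ) (w : E) : ℝ := ∫ y, ‖g (y - w) - g y‖

theorem continuous_translationModulus {g : E → ℂ} (hg : Integrable g) :
    Continuous (translationModulus g) := by
  -- translation acts continuously on `L¹`, and the modulus is the `L¹` norm of a difference
  have key : Continuous fun w : E ↦
      Lp.compMeasurePreserving (fun y ↦ y - w) (measurePreserving_sub_right volume w)
        (hg.toL1 g) := by
    refine Continuous.compMeasurePreservingLp (p := 1) (f := fun _ ↦ hg.toL1 g)
      (g := fun w : E ↦ (⟨fun y ↦ y - w, by fun_prop⟩ : C(E, E))) continuous_const ?_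
      (fun w ↦ measurePreserving_sub_right volume w) (by simp)
    refine ContinuousMap.continuous_of_continuous_uncurry _ ?_
    change Continuous fun p : E × E ↦ p.2 - p.1
    fun_prop
  refine (key.sub (continuous_const (y := hg.toL1 g))).norm.congr fun w ↦ ?_
  have h1 : Lp.compMeasurePreserving (fun y ↦ y - w) (measurePreserving_sub_right volume w)
      (hg.toL1 g) = (hg.comp_sub_right w).toL1 (fun y ↦ g (y - w)) := rfl
  simp only [Pi.sub_apply, h1]
  rw [← Integrable.toL1_sub, L1.norm_of_fun_eq_integral_norm]
  rfl

@[simp]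
theorem translationModulus_zero (g : E → ℂ) : translationModulus g 0 = 0 := by
  simp [translationModulus]

theorem translationModulus_nonneg (g : E → ℂ) (w : E) : 0 ≤ translationModulus g w :=
  integral_nonneg fun _ ↦ norm_nonneg _

theorem translationModulus_le {g : E → ℂ} (hg : Integrable g) (w : E) :
    translationModulus g w ≤ 2 * ∫ y, ‖g y‖ := by
  have h : ∫ y, ‖g (y - w)‖ = ∫ y, ‖g y‖ := integral_sub_right_eq_self (fun y ↦ ‖g y‖) w
  calc translationModulus g w ≤ ∫ y, (‖g (y - w)‖ + ‖g y‖) :=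
        integral_mono ((hg.comp_sub_right w).sub hg).norm ((hg.comp_sub_right w).norm.add hg.norm)
          fun y ↦ norm_sub_le _ _
    _ = 2 * ∫ y, ‖g y‖ := by
        rw [integral_add (hg.comp_sub_right w).norm hg.norm, h, two_mul]

section Bounded

variable {f g : E → ℂ} {M : ℝ}

theorem norm_integral_mul_le_of_bound (hM : ∀ᵐ x, ‖f x‖ ≤ M) (hg : Integrable g) :
    ‖∫ x, f x * g x‖ ≤ M * ∫ x, ‖g x‖ := by
  rw [← integral_const_mul]
  refine norm_integral_le_of_norm_le (hg.norm.const_mul M) ?_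
  filter_upwards [hM] with x hx
  rw [norm_mul]
  gcongr

theorem norm_correlation_le (hM : ∀ᵐ x, ‖f x‖ ≤ M) (hg : Integrable g) (a : E) :
    ‖correlation f g a‖ ≤ M * ∫ x, ‖g x‖ := by
  rw [← integral_sub_right_eq_self (fun y ↦ ‖g y‖) a]
  exact norm_integral_mul_le_of_bound hM (hg.comp_sub_right a)

theorem integrable_mul_comp_sub (hf : AEStronglyMeasurable f) (hM : ∀ᵐ x, ‖f x‖ ≤ M)
    (hg : Integrable g) (a : E) : Integrable fun x ↦ f x * g (x - a) :=
  (hg.comp_sub_right a).bdd_mul hf hM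

theorem correlation_sub {g' : E → ℂ} (hf : AEStronglyMeasurable f) (hM : ∀ᵐ x, ‖f x‖ ≤ M)
    (hg : Integrable g) (hg' : Integrable g') (a : E) :
    correlation f (g - g') a = correlation f g a - correlation f g' a := by
  simp only [correlation, Pi.sub_apply, mul_sub]
  exact integral_sub (integrable_mul_comp_sub hf hM hg a) (integrable_mul_comp_sub hf hM hg' a)

theorem correlation_add {g' : E → ℂ} (hf : AEStronglyMeasurable f) (hM : ∀ᵐ x, ‖f x‖ ≤ M)
    (hg : Integrable g) (hg' : Integrable g') (a : E) :
    correlation f (g + g') a = correlation f g a + correlation f g' a := by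
  simp only [correlation, Pi.add_apply, mul_add]
  exact integral_add (integrable_mul_comp_sub hf hM hg a) (integrable_mul_comp_sub hf hM hg' a)

theorem norm_correlation_sub_le (hf : AEStronglyMeasurable f) (hM : ∀ᵐ x, ‖f x‖ ≤ M)
    (hg : Integrable g) (a b : E) :
    ‖correlation f g a - correlation f g b‖ ≤ M * translationModulus g (a - b) := by
  have h1 : correlation f g a - correlation f g b =
      ∫ x, f x * (g (x - a) - g (x - b)) := by
    simp only [correlation, mul_sub]
    exact (integral_sub (integrable_mul_comp_sub hf hM hg a)
      (integrable_mul_comp_sub hf hM hg b)).symm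
  rw [h1, translationModulus,
    ← integral_sub_right_eq_self (fun y ↦ ‖g (y - (a - b)) - g y‖) b]
  simp only [sub_sub, add_sub_cancel]
  exact norm_integral_mul_le_of_bound hM ((hg.comp_sub_right a).sub (hg.comp_sub_right b))

theorem continuous_correlation (hf : AEStronglyMeasurable f) (hM : ∀ᵐ x, ‖f x‖ ≤ M)
    (hg : Integrable g) : Continuous (correlation f g) := by
  refine continuous_iff_continuousAt.2 fun b ↦ tendsto_iff_norm_sub_tendsto_zero.2 ?_
  have h : Tendsto (fun a ↦ M * translationModulus g (a - b)) (𝓝 b) (𝓝 0) := by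
    have hc : Continuous fun a ↦ M * translationModulus g (a - b) :=
      continuous_const.mul ((continuous_translationModulus hg).comp (continuous_sub_right b))
    simpa using hc.tendsto b
  exact squeeze_zero (fun _ ↦ norm_nonneg _)
    (fun a ↦ norm_correlation_sub_le hf hM hg a b) h

/-- Averaging the correlation with `g` against `h` gives the correlation with the convolution of `h`
and `g`. -/
theorem integral_mul_correlation_add {h : E → ℂ} (hf : AEStronglyMeasurable f)
    (hM : ∀ᵐ x, ‖f x‖ ≤ M) (hh : Integrable h) (hg : Integrable g) (a : E) :
    ∫ y, h y * correlation f g (a + y) =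
      correlation f (h ⋆[ContinuousLinearMap.mul ℂ ℂ] g) a := by
  have hint : Integrable (fun p : E × E ↦ f p.1 * (h p.2 * g (p.1 - a - p.2)))
      (volume.prod volume) := by
    refine Integrable.bdd_mul (c := M) ?_ hf.comp_fst ?_
    · simpa [sub_right_comm] using
        hh.convolution_integrand (ContinuousLinearMap.mul ℂ ℂ) (hg.comp_sub_right a)
    · exact Measure.quasiMeasurePreserving_fst.ae hM
  calc ∫ y, h y * correlation f g (a + y)
      = ∫ y, ∫ x, f x * (h y * g (x - a - y)) := by
        refine integral_congr_ae (.of_forall fun y ↦ ?_)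
        simp only [correlation, ← integral_const_mul, sub_sub]
        exact integral_congr_ae (.of_forall fun x ↦ mul_left_comm _ _ _)
    _ = ∫ x, ∫ y, f x * (h y * g (x - a - y)) := (integral_integral_swap hint).symm
    _ = _ := by
        simp only [correlation, integral_const_mul, convolution_def,
          ContinuousLinearMap.mul_apply']

end Bounded

end Correlation

/-! ### Modulated dilations of a Schwartz kernel -/

section Kernel

variable {E : Type*} [NormedAddCommGroup E] [InnerProductSpace ℝ E] [FiniteDimensional ℝ E]
  [MeasurableSpace E] [BorelSpace E]

theorem fourier_zero_eq_integral (g : E → ℂ) : 𝓕 g 0 = ∫ x, g x := by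
  simp [Real.fourier_eq]

/-- The function `y ↦ ε^d e^{2πi y·ξ₀} H(εy)`, where `d` is the dimension. On the Fourier side this
rescales `𝓕 H` by the factor `ε` and moves its centre from `0` to `ξ₀`, so a small `ε` localizes
sharply in frequency. -/
noncomputable def modulatedDilation (H : E → ℂ) (ξ₀ : E) (ε : ℝ) (y : E) : ℂ :=
  (ε ^ Module.finrank ℝ E : ℝ) • Real.fourierChar (inner ℝ y ξ₀) • H (ε • y)

/-- There is a Schwartz function `H` of integral one all of whose modulated dilations have compactly
supported Fourier transforms, equal to one on the `ε`-ball around `ξ₀`. -/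
theorem exists_kernel : ∃ H : 𝓢(E, ℂ), ∫ y, H y = 1 ∧ ∀ ξ₀ : E, ∀ ε : ℝ, 0 < ε →
    ∃ h : 𝓢(E, ℂ), ⇑h = modulatedDilation H ξ₀ ε ∧
      (∀ ξ ∈ Metric.closedBall ξ₀ ε, (𝓕 h : 𝓢(E, ℂ)) ξ = 1) ∧
      HasCompactSupport (𝓕 h : 𝓢(E, ℂ)) := by
  let η : ContDiffBump (0 : E) := ⟨1, 2, one_pos, one_lt_two⟩
  have hbump : ∀ ξ₀ : E, ∀ ε : ℝ, 0 < ε → ∃ h : 𝓢(E, ℂ),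
      HasCompactSupport (𝓕 h : 𝓢(E, ℂ)) ∧
      ∀ ξ, (𝓕 h : 𝓢(E, ℂ)) ξ = ((η (ε⁻¹ • (ξ - ξ₀)) : ℝ) : ℂ) := by
    intro ξ₀ ε hε
    have h1 : HasCompactSupport fun ξ ↦ ((η (ε⁻¹ • (ξ - ξ₀)) : ℝ) : ℂ) := by
      refine HasCompactSupport.comp_left (g := ((↑) : ℝ → ℂ)) ?_ Complex.ofReal_zero
      exact η.hasCompactSupport.comp_homeomorph
        ((Homeomorph.subRight ξ₀).trans (Homeomorph.smulOfNeZero ε⁻¹ (inv_ne_zero hε.ne')))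
    have h2 : ContDiff ℝ ∞ fun ξ ↦ ((η (ε⁻¹ • (ξ - ξ₀)) : ℝ) : ℂ) :=
      Complex.ofRealCLM.contDiff.comp (η.contDiff.comp (by fun_prop))
    refine ⟨𝓕⁻ (h1.toSchwartzMap h2), ?_, fun ξ ↦ ?_⟩
    · rwa [FourierTransform.fourier_fourierInv_eq]
    · rw [FourierTransform.fourier_fourierInv_eq]
      rfl
  obtain ⟨H, -, hH⟩ := hbump 0 1 one_pos
  have hH' : ∀ y, H y = ∫ ξ, Real.fourierChar (inner ℝ ξ y) • ((η ξ : ℝ) : ℂ) := by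
    intro y
    have : H y = 𝓕⁻ (𝓕 H) y := by simp
    rw [this, SchwartzMap.fourierInv_coe, Real.fourierInv_eq]
    simp [hH]
  refine ⟨H, ?_, fun ξ₀ ε hε ↦ ?_⟩
  · rw [← fourier_zero_eq_integral, ← SchwartzMap.fourier_coe, hH, sub_zero, smul_zero,
      η.one_of_mem_closedBall (Metric.mem_closedBall_self zero_le_one), Complex.ofReal_one]
  · obtain ⟨h, hcs, hh⟩ := hbump ξ₀ ε hε
    refine ⟨h, funext fun y ↦ ?_, fun ξ hξ ↦ ?_, hcs⟩
    · have : h y = 𝓕⁻ (𝓕 h) y := by simp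
      rw [this, SchwartzMap.fourierInv_coe, Real.fourierInv_eq, modulatedDilation, hH']
      simp only [hh]
      let F : E → ℂ := fun ζ ↦ Real.fourierChar (inner ℝ (ξ₀ + ε • ζ) y) • ((η ζ : ℝ) : ℂ)
      calc ∫ ξ, Real.fourierChar (inner ℝ ξ y) • ((η (ε⁻¹ • (ξ - ξ₀)) : ℝ) : ℂ)
          = ∫ ξ, F (ε⁻¹ • (ξ - ξ₀)) := by simp [F, smul_inv_smul₀ hε.ne']
        _ = ∫ ξ, F (ε⁻¹ • ξ) := integral_sub_right_eq_self (fun ξ ↦ F (ε⁻¹ • ξ)) ξ₀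
        _ = (ε ^ Module.finrank ℝ E : ℝ) • ∫ ζ, F ζ :=
            Measure.integral_comp_inv_smul_of_nonneg volume F hε.le
        _ = _ := by
            congr 1
            rw [Circle.smul_def, ← integral_smul]
            refine integral_congr_ae (.of_forall fun ζ ↦ ?_)
            simp only [F, inner_add_left, AddChar.map_add_eq_mul, mul_smul,
              real_inner_smul_right, real_inner_comm, Circle.smul_def]
    · rw [hh, η.one_of_mem_closedBall, Complex.ofReal_one]
      rw [mem_closedBall_zero_iff, norm_smul, norm_inv, Real.norm_of_nonneg hε.le]
      rw [Metric.mem_closedBall, dist_eq_norm] at hξ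
      exact inv_mul_le_one_of_le₀ hξ hε.le

/-- Up to an `L¹` error that tends to `0` with `ε`, translating a modulated dilation by `z`
multiplies it by the character `e^{-2πi z·ξ₀}`. -/
theorem integral_norm_modulatedDilation_sub (H : E → ℂ) (ξ₀ : E) {ε : ℝ} (hε : 0 < ε) (z : E) :
    ∫ y, ‖modulatedDilation H ξ₀ ε (y - z) -
        Real.fourierChar (-inner ℝ z ξ₀) • modulatedDilation H ξ₀ ε y‖ =
      translationModulus H (ε • z) := by
  have hpt : ∀ y, ‖modulatedDilation H ξ₀ ε (y - z) -
        Real.fourierChar (-inner ℝ z ξ₀) • modulatedDilation H ξ₀ ε y‖ =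
      ε ^ Module.finrank ℝ E * (fun y ↦ ‖H (y - ε • z) - H y‖) (ε • y) := by
    intro y
    have : modulatedDilation H ξ₀ ε (y - z) -
          Real.fourierChar (-inner ℝ z ξ₀) • modulatedDilation H ξ₀ ε y =
        (ε ^ Module.finrank ℝ E : ℝ) • Real.fourierChar (inner ℝ y ξ₀ - inner ℝ z ξ₀) •
          (H (ε • y - ε • z) - H (ε • y)) := by
      simp only [modulatedDilation, smul_comm (Real.fourierChar (-inner ℝ z ξ₀)) (_ : ℝ),
        smul_sub, inner_sub_left, sub_eq_neg_add (inner ℝ y ξ₀), AddChar.map_add_eq_mul, mul_smul]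
    rw [this, norm_smul, Circle.norm_smul, Real.norm_of_nonneg (by positivity)]
  rw [integral_congr_ae (.of_forall hpt), integral_const_mul,
    Measure.integral_comp_smul_of_nonneg volume (fun y ↦ ‖H (y - ε • z) - H y‖) ε (hR := hε.le),
    smul_eq_mul, mul_inv_cancel_left₀ (by positivity)]
  rfl

theorem translationModulus_modulatedDilation_zero (H : E → ℂ) {ε : ℝ} (hε : 0 < ε) (z : E) :
    translationModulus (modulatedDilation H 0 ε) z = translationModulus H (ε • z) := by
  rw [← integral_norm_modulatedDilation_sub H 0 hε z]
  simp [translationModulus]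

end Kernel

/-! ### A Tauberian theorem -/

section Local

variable {E : Type*} [NormedAddCommGroup E] [InnerProductSpace ℝ E] [FiniteDimensional ℝ E]
  [MeasurableSpace E] [BorelSpace E]

theorem tendsto_integral_mul_translationModulus {k H : E → ℂ} (hk : Integrable k)
    (hH : Integrable H) :
    Tendsto (fun ε : ℝ ↦ ∫ z, ‖k z‖ * translationModulus H (ε • z)) (𝓝 0) (𝓝 0) := by
  have h : ∫ z, ‖k z‖ * translationModulus H ((0 : ℝ) • z) = 0 := by simp
  nth_rw 2 [← h]
  refine tendsto_integral_filter_of_dominated_convergence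
    (fun z ↦ ‖k z‖ * (2 * ∫ y, ‖H y‖)) (.of_forall fun ε ↦ ?_)
    (.of_forall fun ε ↦ .of_forall fun z ↦ ?_) (hk.norm.mul_const _) (.of_forall fun z ↦ ?_)
  · exact hk.1.norm.mul
      ((continuous_translationModulus hH).comp (continuous_const_smul ε)).aestronglyMeasurable
  · rw [norm_mul, norm_norm, Real.norm_of_nonneg (translationModulus_nonneg _ _)]
    gcongr
    exact translationModulus_le hH _
  · have hc : Continuous fun ε : ℝ ↦ ‖k z‖ * translationModulus H (ε • z) :=
      continuous_const.mul ((continuous_translationModulus hH).comp (by fun_prop))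
    exact hc.tendsto 0

/-- The analytic core of the local step: if `u` is reproduced by averaging against the modulated
dilation `h`, it nearly behaves like the character `e^{-2πi z·ξ₀}` under translation by `z`, so
averaging it against `k` nearly multiplies it by `𝓕 k ξ₀`. If that average vanishes, so does `u`. -/
theorem eq_zero_of_reproducing_of_annihilating {u k h H : E → ℂ} {ξ₀ : E} {ε : ℝ} (hε : 0 < ε)
    (hu : Continuous u) (hb : ∃ S, ∀ a, ‖u a‖ ≤ S) (hk : Integrable k) (hh : Integrable h)
    (hH : Integrable H) (hhH : h = modulatedDilation H ξ₀ ε)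
    (hku : ∀ a, ∫ z, k z * u (a + z) = 0) (hhu : ∀ a, ∫ y, h y * u (a + y) = u a)
    (hsmall : ∫ z, ‖k z‖ * translationModulus H (ε • z) < ‖𝓕 k ξ₀‖) : u = 0 := by
  obtain ⟨S₀, hS₀⟩ := hb
  have hbdd : BddAbove (range fun a ↦ ‖u a‖) := ⟨S₀, by rintro _ ⟨a, rfl⟩; exact hS₀ a⟩
  set S := ⨆ a, ‖u a‖
  have hS : ∀ a, ‖u a‖ ≤ S := le_ciSup hbdd
  set q := ∫ z, ‖k z‖ * translationModulus H (ε • z)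
  have hintu : ∀ {g : E → ℂ} (a : E), Integrable g → Integrable fun y ↦ g y * u (a + y) :=
    fun a hg ↦ hg.mul_bdd (c := S) (by fun_prop) (.of_forall fun y ↦ hS _)
  -- `u` nearly transforms by a character: apply the reproducing formula at `a` and at `a + z`
  have hdiff : ∀ a z, ‖Real.fourierChar (-inner ℝ z ξ₀) • u a - u (a + z)‖ ≤
      S * translationModulus H (ε • z) := by
    intro a z
    have h1 : Real.fourierChar (-inner ℝ z ξ₀) • u a - u (a + z) =
        ∫ y, u (a + y) * (Real.fourierChar (-inner ℝ z ξ₀) • h y - h (y - z)) := by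
      have h2 : u (a + z) = ∫ y, h (y - z) * u (a + y) := by
        rw [← hhu (a + z), ← integral_sub_right_eq_self (fun y ↦ h y * u (a + z + y)) z]
        simp [add_assoc]
      rw [h2, ← hhu a, Circle.smul_def, smul_eq_mul, ← integral_const_mul,
        ← integral_sub ((hintu a hh).const_mul _) (hintu a (hh.comp_sub_right z))]
      refine integral_congr_ae (.of_forall fun y ↦ ?_)
      simp only [Circle.smul_def, smul_eq_mul]
      ring
    rw [h1, ← integral_norm_modulatedDilation_sub H ξ₀ hε z, ← hhH]
    simp_rw [norm_sub_rev (h (_ - z))]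
    have hi : Integrable fun y ↦ Real.fourierChar (-inner ℝ z ξ₀) • h y - h (y - z) :=
      (hh.const_mul _).sub (hh.comp_sub_right z)
    exact norm_integral_mul_le_of_bound (.of_forall fun y ↦ hS _) hi
  have hchar : Integrable fun z ↦ Real.fourierChar (-inner ℝ z ξ₀) • k z :=
    (Real.fourierIntegral_convergent_iff ξ₀).2 hk
  -- subtracting the vanishing average of `u` against `k` leaves only the small error
  have hmain : ∀ a, ‖𝓕 k ξ₀‖ * ‖u a‖ ≤ S * q := by
    intro a
    have h1 : 𝓕 k ξ₀ * u a =
        ∫ z, k z * (Real.fourierChar (-inner ℝ z ξ₀) • u a - u (a + z)) := by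
      rw [Real.fourier_eq, ← integral_mul_const, ← sub_zero (∫ z, _), ← hku a,
        ← integral_sub (hchar.mul_const _) (hintu a hk)]
      refine integral_congr_ae (.of_forall fun y ↦ ?_)
      simp only [Circle.smul_def, smul_eq_mul]
      ring
    rw [← norm_mul, h1, ← integral_const_mul]
    refine norm_integral_le_of_norm_le ?_ (.of_forall fun z ↦ ?_)
    · refine (hk.norm.mul_bdd (c := 2 * ∫ y, ‖H y‖) ?_ (.of_forall fun z ↦ ?_)).const_mul S
      · exact ((continuous_translationModulus hH).comp
          (continuous_const_smul ε)).aestronglyMeasurable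
      · rw [Real.norm_of_nonneg (translationModulus_nonneg _ _)]
        exact translationModulus_le hH _
    · rw [norm_mul, mul_left_comm]
      exact mul_le_mul_of_nonneg_left (hdiff a z) (norm_nonneg _)
  have hSle : ‖𝓕 k ξ₀‖ * S ≤ S * q := by
    rw [Real.mul_iSup_of_nonneg (norm_nonneg _)]
    exact ciSup_le hmain
  have hS0 : S ≤ 0 := by
    by_contra! hpos
    nlinarith
  exact funext fun a ↦ norm_le_zero_iff.1 ((hS a).trans hS0)

variable {f : E → ℂ} {M : ℝ}

/-- If `f` is orthogonal to all translates of some `k` with `𝓕 k ξ₀ ≠ 0`, it is orthogonal to all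
translates of Schwartz functions with frequencies near `ξ₀`. -/
theorem exists_ball_correlation_eq_zero (hf : AEStronglyMeasurable f) (hM : ∀ᵐ x, ‖f x‖ ≤ M)
    {k : E → ℂ} (hk : Integrable k) (hfk : correlation f k = 0) {ξ₀ : E} (hξ₀ : 𝓕 k ξ₀ ≠ 0) :
    ∃ ε > 0, ∀ ψ : 𝓢(E, ℂ), tsupport (𝓕 ψ : 𝓢(E, ℂ)) ⊆ Metric.ball ξ₀ ε →
      correlation f ψ = 0 := by
  obtain ⟨H, -, hH⟩ := exists_kernel (E := E)
  have hlim := tendsto_integral_mul_translationModulus hk H.integrable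
  have hev : ∀ᶠ ε : ℝ in 𝓝[>] 0,
      ∫ z, ‖k z‖ * translationModulus H (ε • z) < ‖𝓕 k ξ₀‖ :=
    (hlim.eventually_lt_const (norm_pos_iff.2 hξ₀)).filter_mono nhdsWithin_le_nhds
  obtain ⟨ε, hsmall, hε⟩ := (hev.and self_mem_nhdsWithin).exists
  obtain ⟨h, hhH, hh1, -⟩ := hH ξ₀ ε hε
  refine ⟨ε, hε, fun ψ hψ ↦ ?_⟩
  -- the transform of `h` is one on the frequency support of `ψ`
  have hconv : ((h : E → ℂ) ⋆[ContinuousLinearMap.mul ℂ ℂ] ψ) = ψ := by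
    have h1 : SchwartzMap.convolution (ContinuousLinearMap.mul ℂ ℂ) h ψ = ψ := by
      refine (FourierTransform.fourierCLE ℂ 𝓢(E, ℂ)).injective ?_
      rw [FourierTransform.fourierCLE_apply, FourierTransform.fourierCLE_apply,
        SchwartzMap.fourier_convolution]
      ext ξ
      by_cases hξ : ξ ∈ tsupport (𝓕 ψ : 𝓢(E, ℂ))
      · simp [hh1 ξ (Metric.ball_subset_closedBall (hψ hξ))]
      · simp [image_eq_zero_of_notMem_tsupport hξ]
    funext x
    rw [← SchwartzMap.convolution_apply, h1]
  refine eq_zero_of_reproducing_of_annihilating hε (continuous_correlation hf hM ψ.integrable)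
    ⟨_, norm_correlation_le hM ψ.integrable⟩ hk h.integrable H.integrable hhH (fun a ↦ ?_)
    (fun a ↦ ?_) hsmall
  -- convolution commutes, and the correlation with `k` vanishes
  · rw [integral_mul_correlation_add hf hM hk ψ.integrable, ← MeasureTheory.convolution_flip,
      ContinuousLinearMap.flip_mul,
      ← integral_mul_correlation_add hf hM ψ.integrable hk, hfk]
    simp
  · rw [integral_mul_correlation_add hf hM h.integrable ψ.integrable, hconv]

/-- A Schwartz function whose Fourier transform is compactly supported in `U ∪ V` is a sum of two,
one with frequencies in `U` and one with frequencies in `V`. -/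
theorem exists_schwartz_split (ψ : 𝓢(E, ℂ)) (hψ : HasCompactSupport (𝓕 ψ : 𝓢(E, ℂ)))
    {U V : Set E} (hU : IsOpen U) (hV : IsOpen V)
    (hUV : tsupport (𝓕 ψ : 𝓢(E, ℂ)) ⊆ U ∪ V) :
    ∃ ψ₁ ψ₂ : 𝓢(E, ℂ), ψ = ψ₁ + ψ₂ ∧
      (HasCompactSupport (𝓕 ψ₁ : 𝓢(E, ℂ)) ∧ tsupport (𝓕 ψ₁ : 𝓢(E, ℂ)) ⊆ U) ∧
      (HasCompactSupport (𝓕 ψ₂ : 𝓢(E, ℂ)) ∧ tsupport (𝓕 ψ₂ : 𝓢(E, ℂ)) ⊆ V) := by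
  set K := tsupport (𝓕 ψ : 𝓢(E, ℂ))
  have hK : IsClosed K := isClosed_tsupport _
  obtain ⟨ρ, hρ0, hρ1, -⟩ := exists_contMDiffMap_zero_one_nhds_of_isClosed (n := ⊤)
    (modelWithCornersSelf ℝ E) (hK.sdiff hU) (hK.sdiff hV) (by
      rw [Set.disjoint_left]
      rintro x ⟨hxK, hxU⟩ ⟨-, hxV⟩
      exact (hUV hxK).elim hxU hxV)
  have hρ : ContDiff ℝ ∞ fun ξ ↦ ((ρ ξ : ℝ) : ℂ) :=
    Complex.ofRealCLM.contDiff.comp ρ.contMDiff.contDiff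
  -- the piece of `ψ` cut out by a smooth multiplier vanishing near the part of `K` outside `W`
  have piece : ∀ (r : E → ℂ) (W : Set E), ContDiff ℝ ∞ r → (∀ᶠ ξ in 𝓝ˢ (K \ W), r ξ = 0) →
      ∃ χ : 𝓢(E, ℂ), (∀ ξ, (𝓕 χ : 𝓢(E, ℂ)) ξ = r ξ * (𝓕 ψ : 𝓢(E, ℂ)) ξ) ∧
        HasCompactSupport (𝓕 χ : 𝓢(E, ℂ)) ∧ tsupport (𝓕 χ : 𝓢(E, ℂ)) ⊆ W := by
    intro r W hr hr0
    have hcs : HasCompactSupport fun ξ ↦ r ξ * (𝓕 ψ : 𝓢(E, ℂ)) ξ := hψ.mul_left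
    have hχ : ((𝓕 (𝓕⁻ (hcs.toSchwartzMap (hr.mul (𝓕 ψ : 𝓢(E, ℂ)).smooth')) : 𝓢(E, ℂ)) :
        𝓢(E, ℂ)) : E → ℂ) = fun ξ ↦ r ξ * (𝓕 ψ : 𝓢(E, ℂ)) ξ := by
      rw [FourierTransform.fourier_fourierInv_eq]
      rfl
    refine ⟨𝓕⁻ (hcs.toSchwartzMap (hr.mul (𝓕 ψ : 𝓢(E, ℂ)).smooth')), fun ξ ↦ congrFun hχ ξ,
      by rwa [hχ], fun ξ hξ ↦ ?_⟩
    rw [hχ] at hξ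
    by_contra hW
    refine notMem_tsupport_iff_eventuallyEq.2 ?_ hξ
    filter_upwards [eventually_nhdsSet_iff_forall.1 hr0 ξ
      ⟨closure_mono (Function.support_mul_subset_right _ _) hξ, hW⟩] with x hx
    simp [hx]
  obtain ⟨ψ₁, h1, hc1, hs1⟩ := piece _ U hρ (hρ0.mono fun ξ h ↦ by simp [h])
  obtain ⟨ψ₂, h2, hc2, hs2⟩ := piece _ V (contDiff_const (c := (1 : ℂ)) |>.sub hρ)
    (hρ1.mono fun ξ h ↦ by simp [h])
  refine ⟨ψ₁, ψ₂, (FourierTransform.fourierCLE ℂ 𝓢(E, ℂ)).injective ?_, ⟨hc1, hs1⟩, ⟨hc2, hs2⟩⟩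
  ext ξ
  simp only [map_add, FourierTransform.fourierCLE_apply, add_apply, h1, h2]
  ring

/-- If each frequency in `Ω` is seen by some `k` whose translates are orthogonal to `f`, then `f` is
orthogonal to all translates of Schwartz functions with compact frequency support in `Ω`. -/
theorem correlation_eq_zero_of_hasCompactSupport_fourier (hf : AEStronglyMeasurable f)
    (hM : ∀ᵐ x, ‖f x‖ ≤ M) {Ω : Set E}
    (hk : ∀ ξ ∈ Ω, ∃ k, Integrable k ∧ correlation f k = 0 ∧ 𝓕 k ξ ≠ 0) (ψ : 𝓢(E, ℂ))
    (hψ : HasCompactSupport (𝓕 ψ : 𝓢(E, ℂ))) (hψΩ : tsupport (𝓕 ψ : 𝓢(E, ℂ)) ⊆ Ω) :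
    correlation f ψ = 0 := by
  -- compactness of the frequency support reduces to the local step
  have hind : ∃ U, IsOpen U ∧ tsupport (𝓕 ψ : 𝓢(E, ℂ)) ⊆ U ∧ ∀ χ : 𝓢(E, ℂ),
      HasCompactSupport (𝓕 χ : 𝓢(E, ℂ)) → tsupport (𝓕 χ : 𝓢(E, ℂ)) ⊆ U →
        correlation f χ = 0 := by
    refine IsCompact.induction_on (p := fun s ↦ ∃ U, IsOpen U ∧ s ⊆ U ∧ ∀ χ : 𝓢(E, ℂ),
      HasCompactSupport (𝓕 χ : 𝓢(E, ℂ)) → tsupport (𝓕 χ : 𝓢(E, ℂ)) ⊆ U →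
        correlation f χ = 0) hψ ?_ ?_ ?_ ?_
    · refine ⟨∅, isOpen_empty, Subset.rfl, fun χ _ hχ ↦ ?_⟩
      have h0 : (𝓕 χ : 𝓢(E, ℂ)) = 0 :=
        DFunLike.coe_injective (tsupport_eq_empty_iff.1 (subset_empty_iff.1 hχ))
      have h1 : χ = 0 := (FourierTransform.fourierCLE ℂ 𝓢(E, ℂ)).injective (by simpa using h0)
      ext a
      simp [h1, correlation]
    · rintro s t hst ⟨U, hU, htU, h⟩
      exact ⟨U, hU, hst.trans htU, h⟩
    · rintro s t ⟨U, hU, hsU, h⟩ ⟨V, hV, htV, h'⟩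
      refine ⟨U ∪ V, hU.union hV, union_subset_union hsU htV, fun χ hχ hχs ↦ ?_⟩
      obtain ⟨χ₁, χ₂, rfl, ⟨hc1, hs1⟩, hc2, hs2⟩ := exists_schwartz_split χ hχ hU hV hχs
      funext a
      rw [show ⇑(χ₁ + χ₂) = ⇑χ₁ + ⇑χ₂ from rfl,
        correlation_add hf hM χ₁.integrable χ₂.integrable, h χ₁ hc1 hs1, h' χ₂ hc2 hs2]
      simp
    · intro ξ hξ
      obtain ⟨k, hki, hfk, hkξ⟩ := hk ξ (hψΩ hξ)
      obtain ⟨ε, hε, h⟩ := exists_ball_correlation_eq_zero hf hM hki hfk hkξ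
      exact ⟨_, mem_nhdsWithin_of_mem_nhds (Metric.ball_mem_nhds ξ hε), _, Metric.isOpen_ball,
        Subset.rfl, fun χ _ hχ ↦ h χ hχ⟩
  obtain ⟨U, -, hU, h⟩ := hind
  exact h ψ hψ hU

/-- Tauberian theorem: a bounded function is almost everywhere constant if, for each frequency
`ξ ≠ 0`, it is orthogonal to all translates of some integrable `k` with `𝓕 k ξ ≠ 0`. -/
theorem exists_ae_eq_const_of_correlation_eq_zero (hf : AEStronglyMeasurable f)
    (hM : ∀ᵐ x, ‖f x‖ ≤ M)
    (hk : ∀ ξ ≠ 0, ∃ k, Integrable k ∧ correlation f k = 0 ∧ 𝓕 k ξ ≠ 0) :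
    ∃ c, ∀ᵐ x, f x = c := by
  obtain ⟨H, hH1, hH⟩ := exists_kernel (E := E)
  let χ : ℝ → E → ℂ := modulatedDilation H 0
  have hχi : ∀ ε, 0 < ε → Integrable (χ ε) := fun ε hε ↦ by
    obtain ⟨h, hh, -⟩ := hH 0 ε hε
    simpa only [χ, ← hh] using h.integrable
  -- `χ ε - χ δ` has Fourier transform vanishing near `0`
  have hχ : ∀ ε δ, 0 < ε → 0 < δ → correlation f (χ ε) = correlation f (χ δ) := by
    intro ε δ hε hδ
    obtain ⟨h, hh, hh1, hhc⟩ := hH 0 ε hε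
    obtain ⟨h', hh', hh1', hhc'⟩ := hH 0 δ hδ
    have hF : ((𝓕 (h - h') : 𝓢(E, ℂ)) : E → ℂ) =
        (𝓕 h : 𝓢(E, ℂ)) - (𝓕 h' : 𝓢(E, ℂ)) := by
      rw [show 𝓕 (h - h') = 𝓕 h - 𝓕 h' from map_sub (FourierTransform.fourierCLE ℂ 𝓢(E, ℂ)) h h']
      rfl
    have h0 := correlation_eq_zero_of_hasCompactSupport_fourier hf hM (Ω := {0}ᶜ)
      (fun ξ hξ ↦ hk ξ hξ) (h - h') (by rw [hF]; exact hhc.sub hhc') (by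
        rintro ξ hξ rfl
        refine notMem_tsupport_iff_eventuallyEq.2 ?_ hξ
        filter_upwards [Metric.closedBall_mem_nhds (0 : E) hε,
          Metric.closedBall_mem_nhds (0 : E) hδ] with ξ h1 h2
        simp [hF, hh1 ξ h1, hh1' ξ h2])
    funext a
    have h1 := correlation_sub hf hM h.integrable h'.integrable a
    rw [show ⇑h - ⇑h' = ⇑(h - h') from rfl, h0, hh, hh'] at h1
    exact (sub_eq_zero.1 h1.symm)
  -- letting `ε → 0`, `correlation f (χ 1)` is constant
  have hconst : ∀ a b, correlation f (χ 1) a = correlation f (χ 1) b := by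
    intro a b
    have hle : ∀ ε : ℝ, 0 < ε → ‖correlation f (χ 1) a - correlation f (χ 1) b‖ ≤
        M * translationModulus H (ε • (a - b)) := fun ε hε ↦ by
      rw [hχ 1 ε one_pos hε, ← translationModulus_modulatedDilation_zero _ hε]
      exact norm_correlation_sub_le hf hM (hχi ε hε) a b
    have hc : Continuous fun ε : ℝ ↦ M * translationModulus H (ε • (a - b)) :=
      continuous_const.mul ((continuous_translationModulus H.integrable).comp (by fun_prop))
    have ht : Tendsto (fun ε : ℝ ↦ M * translationModulus H (ε • (a - b))) (𝓝[>] 0) (𝓝 0) := by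
      simpa using (hc.tendsto 0).mono_left nhdsWithin_le_nhds
    refine sub_eq_zero.1 (norm_le_zero_iff.1 (ge_of_tendsto ht ?_))
    filter_upwards [self_mem_nhdsWithin] with ε hε using hle ε hε
  set c := correlation f (χ 1) 0
  have hc : ∀ ε, 0 < ε → ∀ a, correlation f (χ ε) a = c := fun ε hε a ↦ by
    rw [hχ ε 1 hε one_pos]
    exact hconst a 0
  -- letting `ε → ∞`, pairing `f` with a test function gives `c` times the integral
  have hpair : ∀ φ : E → ℂ, Integrable φ → ∫ x, f x * φ x = c * ∫ x, φ x := by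
    intro φ hφ
    have heq : ∀ ε : ℝ, 0 < ε → ∫ y, H y * correlation f φ (ε⁻¹ • y) = c * ∫ x, φ x := by
      intro ε hε
      have h1 := integral_mul_correlation_add hf hM (hχi ε hε) hφ 0
      rw [← MeasureTheory.convolution_flip, ContinuousLinearMap.flip_mul,
        ← integral_mul_correlation_add hf hM hφ (hχi ε hε)] at h1
      simp only [hc ε hε, integral_mul_const, zero_add] at h1
      rw [mul_comm c, ← h1]
      have h2 := Measure.integral_comp_smul_of_nonneg volume
        (fun y ↦ H y * correlation f φ (ε⁻¹ • y)) ε (hR := hε.le)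
      rw [eq_inv_smul_iff₀ (by positivity), ← integral_smul] at h2
      rw [← h2]
      refine integral_congr_ae (.of_forall fun y ↦ ?_)
      simp [χ, modulatedDilation, inv_smul_smul₀ hε.ne', mul_assoc]
    have hcont := continuous_correlation hf hM hφ
    have hlim : Tendsto (fun ε : ℝ ↦ ∫ y, H y * correlation f φ (ε⁻¹ • y)) atTop
        (𝓝 (∫ y, H y * correlation f φ 0)) := by
      refine tendsto_integral_filter_of_dominated_convergence
        (fun y ↦ ‖H y‖ * (M * ∫ x, ‖φ x‖)) (.of_forall fun ε ↦ ?_)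
        (.of_forall fun ε ↦ .of_forall fun y ↦ ?_) (H.integrable.norm.mul_const _)
        (.of_forall fun y ↦ ?_)
      · exact (H.continuous.mul (hcont.comp (continuous_const_smul _))).aestronglyMeasurable
      · rw [norm_mul]
        gcongr
        exact norm_correlation_le hM hφ _
      · refine tendsto_const_nhds.mul ((hcont.tendsto 0).comp ?_)
        simpa using (tendsto_inv_atTop_zero (𝕜 := ℝ)).smul_const y
    have h0 : ∫ y, H y * correlation f φ 0 = ∫ x, f x * φ x := by
      rw [integral_mul_const, hH1, one_mul]
      simp [correlation]
    rw [← h0]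
    refine tendsto_nhds_unique hlim (tendsto_const_nhds.congr' ?_)
    filter_upwards [eventually_gt_atTop 0] with ε hε using (heq ε hε).symm
  refine ⟨c, ae_eq_of_integral_contDiff_smul_eq ?_ (locallyIntegrable_const c)
    fun g hg hgc ↦ ?_⟩
  · exact (memLp_top_of_bound hf M hM).locallyIntegrable le_top
  · have hgi : Integrable fun x ↦ (g x : ℂ) :=
      (hg.continuous.integrable_of_hasCompactSupport hgc).ofReal
    have := hpair _ hgi
    simpa [Complex.real_smul, mul_comm, integral_mul_const] using this

end Local

/-! ### Fourier multipliers and plane waves -/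

section Multiplier

variable {n : ℕ}

/-- Comparison of `fourierHat` with Mathlib's transform `𝓕`, whose phase is `e^{-2πi x·ξ}`. -/
theorem fourierHat_two_pi_smul (φ : EuclideanSpace ℝ (Fin n) → ℂ) (ξ : EuclideanSpace ℝ (Fin n)) :
    fourierHat φ ((2 * Real.pi) • ξ) = ((2 * (Real.pi : ℂ)) ^ n)⁻¹ * 𝓕 φ ξ := by
  rw [fourierHat, Real.fourier_eq']
  congr 1
  refine integral_congr_ae (.of_forall fun x ↦ ?_)
  simp only [real_inner_smul_right, smul_eq_mul]
  congr 2
  push_cast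
  ring

theorem fourierHat_comp_sub (φ : EuclideanSpace ℝ (Fin n) → ℂ) (a ξ : EuclideanSpace ℝ (Fin n)) :
    fourierHat (fun x ↦ φ (x - a)) ξ =
      Complex.exp (-(Complex.I * ((inner ℝ a ξ : ℝ) : ℂ))) * fourierHat φ ξ := by
  rw [fourierHat, fourierHat, mul_left_comm]
  congr 1
  rw [← integral_const_mul, ← integral_sub_right_eq_self (fun x ↦
    Complex.exp (-(Complex.I * ((inner ℝ a ξ : ℝ) : ℂ))) *
      (Complex.exp (-(Complex.I * ((inner ℝ x ξ : ℝ) : ℂ))) * φ x)) a]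
  refine integral_congr_ae (.of_forall fun x ↦ ?_)
  simp only [← mul_assoc, ← Complex.exp_add, inner_sub_left]
  congr 2
  push_cast
  ring

theorem IsMultiplierImage.comp_sub {κ φ g : EuclideanSpace ℝ (Fin n) → ℂ}
    (h : IsMultiplierImage κ φ g) (a : EuclideanSpace ℝ (Fin n)) :
    IsMultiplierImage κ (fun x ↦ φ (x - a)) (fun x ↦ g (x - a)) := by
  refine ⟨h.1.comp_sub_right a, fun ξ ↦ ?_⟩
  simp only [fourierHat_comp_sub, h.2 ξ, mul_left_comm]

theorem IsTestFunction.comp_sub {φ : EuclideanSpace ℝ (Fin n) → ℂ} (h : IsTestFunction φ)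
    (a : EuclideanSpace ℝ (Fin n)) : IsTestFunction fun x ↦ φ (x - a) :=
  ⟨h.1.comp (contDiff_id.sub contDiff_const), h.2.comp_homeomorph (Homeomorph.subRight a)⟩

theorem IsDistribSolution.correlation_eq_zero {m f φ g : EuclideanSpace ℝ (Fin n) → ℂ}
    (hf : IsDistribSolution m f) (hφ : IsTestFunction φ)
    (hg : IsMultiplierImage (reflectFun m) φ g) : correlation f g = 0 :=
  funext fun a ↦ hf _ (hφ.comp_sub a) _ (hg.comp_sub a)

theorem exists_testFunction_fourierHat_ne_zero (ξ : EuclideanSpace ℝ (Fin n)) :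
    ∃ φ, IsTestFunction φ ∧ fourierHat φ ξ ≠ 0 := by
  let η : ContDiffBump (0 : EuclideanSpace ℝ (Fin n)) := ⟨1, 2, one_pos, one_lt_two⟩
  refine ⟨fun x ↦ Complex.exp (Complex.I * ((inner ℝ x ξ : ℝ) : ℂ)) * ((η x : ℝ) : ℂ),
    ⟨?_, ?_⟩, ?_⟩
  · have h1 : ContDiff ℝ ∞ fun x : EuclideanSpace ℝ (Fin n) ↦ ((inner ℝ x ξ : ℝ) : ℂ) :=
      Complex.ofRealCLM.contDiff.comp (contDiff_id.inner ℝ contDiff_const)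
    exact (contDiff_const.mul h1).cexp.mul (Complex.ofRealCLM.contDiff.comp η.contDiff)
  · exact (η.hasCompactSupport.comp_left (g := ((↑) : ℝ → ℂ)) Complex.ofReal_zero).mul_left
  · have h : fourierHat (fun x ↦ Complex.exp (Complex.I * ((inner ℝ x ξ : ℝ) : ℂ)) *
        ((η x : ℝ) : ℂ)) ξ = ((2 * (Real.pi : ℂ)) ^ n)⁻¹ * ((∫ x, η x : ℝ) : ℂ) := by
      rw [fourierHat, ← integral_complex_ofReal]
      simp [← mul_assoc, ← Complex.exp_add]
    rw [h]
    have : ((∫ x, η x : ℝ) : ℂ) ≠ 0 := Complex.ofReal_ne_zero.2 η.integral_pos.ne'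
    exact mul_ne_zero (by simp [Real.pi_ne_zero]) this

theorem ae_eq_const_of_isDistribSolution {m : EuclideanSpace ℝ (Fin n) → ℂ}
    (hmap : MultiplierMapsIntoL1 (reflectFun m)) (hzero : {η | m η = 0} ⊆ {0})
    {f : EuclideanSpace ℝ (Fin n) → ℂ} (hf : MemLp f ⊤ volume) (hsol : IsDistribSolution m f) :
    ∃ c, ∀ᵐ x, f x = c := by
  refine exists_ae_eq_const_of_correlation_eq_zero hf.1
    (ae_le_lpNorm_exponent_top hf) fun ξ hξ ↦ ?_
  have h2pi : 2 * Real.pi ≠ 0 := by positivity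
  obtain ⟨φ, hφ, hφξ⟩ := exists_testFunction_fourierHat_ne_zero ((2 * Real.pi) • ξ)
  obtain ⟨g, hg⟩ := hmap φ hφ
  refine ⟨g, hg.1, hsol.correlation_eq_zero hφ hg, fun h0 ↦ ?_⟩
  have h1 := hg.2 ((2 * Real.pi) • ξ)
  rw [fourierHat_two_pi_smul, h0, mul_zero] at h1
  have h2 : m (-((2 * Real.pi) • ξ)) = 0 := (mul_eq_zero.1 h1.symm).resolve_right hφξ
  have h3 : -((2 * Real.pi) • ξ) = 0 := hzero h2
  exact (smul_ne_zero h2pi hξ) (neg_eq_zero.1 h3)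

/-- The plane wave `x ↦ e^{i x·η}` of frequency `η`. -/
noncomputable def planeWave (η x : EuclideanSpace ℝ (Fin n)) : ℂ :=
  Complex.exp (Complex.I * ((inner ℝ x η : ℝ) : ℂ))

theorem continuous_planeWave (η : EuclideanSpace ℝ (Fin n)) : Continuous (planeWave η) := by
  unfold planeWave
  fun_prop

theorem norm_planeWave (η x : EuclideanSpace ℝ (Fin n)) : ‖planeWave η x‖ = 1 := by
  rw [planeWave, mul_comm, Complex.norm_exp_ofReal_mul_I]

/-- The pairing of the plane wave with `g` is `(2π)ⁿ` times the Fourier transform of `g` at `-η`,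
which has `m η` as a factor. -/
theorem isDistribSolution_planeWave {m : EuclideanSpace ℝ (Fin n) → ℂ}
    {η : EuclideanSpace ℝ (Fin n)} (hη : m η = 0) : IsDistribSolution m (planeWave η) := by
  intro φ _ g hg
  have h := hg.2 (-η)
  simp only [reflectFun, neg_neg, hη, zero_mul, fourierHat] at h
  have hpi : ((2 * (Real.pi : ℂ)) ^ n)⁻¹ ≠ 0 := by simp [Real.pi_ne_zero]
  simpa [planeWave] using (mul_eq_zero.1 h).resolve_left hpi

theorem eq_zero_of_planeWave_ae_eq_const {η : EuclideanSpace ℝ (Fin n)} {c : ℂ}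
    (h : ∀ᵐ x, planeWave η x = c) : η = 0 := by
  have hc : planeWave η = fun _ ↦ c :=
    Measure.eq_of_ae_eq h (continuous_planeWave η) continuous_const
  by_contra hη
  -- at this point the phase is `π`
  have h1 : planeWave η ((Real.pi / ‖η‖ ^ 2) • η) = planeWave η 0 := by rw [hc]
  have h2 : Real.pi / ‖η‖ ^ 2 * ‖η‖ ^ 2 = Real.pi :=
    div_mul_cancel₀ _ (pow_ne_zero 2 (norm_ne_zero_iff.2 hη))
  rw [planeWave, planeWave, real_inner_smul_left, real_inner_self_eq_norm_sq, h2, mul_comm,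
    Complex.exp_pi_mul_I] at h1
  norm_num at h1

end Multiplier

end LiouvilleTheorem

theorem theorem1p4 (n : ℕ) (m : EuclideanSpace ℝ (Fin n) → ℂ) (hm : Continuous m)
    (hmap : MultiplierMapsIntoL1 (reflectFun m)) :
    ({η | m η = 0} ⊆ {0} →
      ∀ f : EuclideanSpace ℝ (Fin n) → ℂ, MemLp f ⊤ volume → IsDistribSolution m f →
        ∃ c : ℂ, ∀ᵐ x ∂(volume : Measure (EuclideanSpace ℝ (Fin n))), f x = c) ∧
    ((∀ f : EuclideanSpace ℝ (Fin n) → ℂ, MemLp f ⊤ volume → IsDistribSolution m f →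
        ∃ c : ℂ, ∀ᵐ x ∂(volume : Measure (EuclideanSpace ℝ (Fin n))), f x = c) →
      {η | m η = 0} ⊆ {0}) := by
  refine ⟨fun hzero f hf hsol ↦ ae_eq_const_of_isDistribSolution hmap hzero hf hsol,
    fun h η hη ↦ ?_⟩
  obtain ⟨c, hc⟩ := h (planeWave η)
    (memLp_top_of_bound (continuous_planeWave η).aestronglyMeasurable 1
      (.of_forall fun x ↦ (norm_planeWave η x).le)) (isDistribSolution_planeWave hη)
  exact eq_zero_of_planeWave_ae_eq_const hc
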